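/- **Setting.** A one-mode state is described by its Wigner function on the phase space of points $(x,p)$. The coherent state $|z_0\rangle$, $z_0=(x_0,p_0)$, has wave function $\pi^{-1/4}e^{-(x-x_0)^2/2+ip_0x}$ (up to a phase), and the Wigner function of a wave function $\psi$ is $W(x,p)=\frac1\pi\int e^{2ipy}\psi(x-y)\overline{\psi(x+y)}\,dy$. A homodyne measurement under angle $\theta$ returns a value distributed as the marginal of $W$ along $x_\theta=x\cos\theta+p\sin\theta$. The two-mode squeezed vacuum with parameter $\zeta\ge0$ on modes $A,B$ is the centred Gaussian state with Wigner function $\pi^{-2}\exp(-\mathbf r^T\Gamma(\zeta)^{-1}\mathbf r)$, $\mathbf r=(x_a,p_a,x_b,p_b)$, $\Gamma(\zeta)=\begin{pmatrix}\cosh(2\zeta)\mathbb 1&\sinh(2\zeta)Z\\ \sinh(2\zeta)Z&\cosh(2\zeta)\mathbb 1\end{pmatrix}$, $Z=\mathrm{diag}(1,-1)$. The ideal EPR pair has the (non-normalizable) Wigner distribution $C\,\delta(x_a-x_b)\delta(p_a+p_b)$, $C>0$; laws of measurement results on it are understood conditionally on the teleportation outcome. **Protocol (one round).** For an angle $\theta$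 and $r,r^\perp\in\mathbb R$, verifier $V_1$ sends the coherent state with $(x_0,p_0)=(r\cos\theta+r^\perp\sin\theta,\ r\sin\theta-r^\perp\cos\theta)$ and $V_2$ sends $\theta$. The prover homodynes under $\theta$ and sends the result $r'$ to both verifiers. Over a channel with attenuation $t\in[0,1]$ and excess noise $u\ge0$ the prover receives the Gaussian state with displacement $\sqrt t\,(x_0,p_0)$ and covariance matrix $(1+2u)\mathbb 1$. After $n$ rounds the verifiers accept if the answers arrive on time, both hear the same values, and $\frac1n\sum_i\frac{(r_i'-r_i\sqrt t)^2}{1/2+u}<1+\frac2{\sqrt n}\sqrt{\ln\frac1\varepsilon}+\frac2n\ln\frac1\varepsilon$, where $\varepsilon\in(0,1)$. **Attack (one round, one pre-shared pair).** Alice mixes the intercepted state $\psi$ with her mode $A$ on a balanced beamsplitter with outputs $(\psi+A)/\sqrt2$, $(-\psi+A)/\sqrt2$. She measures $p$ in the first output (outcome $m_p$) and $x$ in the second (outcome $m_x$), and forwards $(d_x,d_p)=(\sqrt2\,m_x,-\sqrt2\,m_p)$ to Bob. Bob intercepts $\theta$, homodynes his mode $B$ under $\theta$ with outcome $\mu$,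 and forwards $(\theta,\mu)$ to Alice. Alice answers $r'=\mu-d_x\cos\theta-d_p\sin\theta$ to $V_1$, and Bob answers the same expression to $V_2$. To imitate a channel $(t,u)$, one attacker also draws an independent $\xi\sim\mathcal N(0,\frac{1-t}2+u)$ and forwards it, and both answer $\sqrt t\,r'+\xi$. **Theorem.** 1. As $\zeta\to\infty$, $\frac\pi2e^{2\zeta}$ times the Wigner function of the two-mode squeezed vacuum converges to $\delta(x_a-x_b)\delta(p_a+p_b)$ when tested against continuous compactly supported functions. 2. For all $\theta,r,r^\perp$ and $C>0$: the honest noiseless answer has law $\mathcal N(r,\frac12)$ (shot noise). With an ideal EPR pair, the joint distribution of $d=(d_x,d_p)$ and Bob's mode is $C\,\mathrm dd$ times the Wigner distribution of the coherent state $|z_0+d\rangle$; and the joint distribution of $(m_x,m_p)$ and the two answers is the product of $2C$ times Lebesgue measure and the law of $(R,R)$, where $R$ has exactly the honest law. So for every teleportation outcome both attackers give one and the same sample of the honest distribution. 3. For all $t\in[0,1]$, $u\ge0$: the honest answer has law $\mathcal N(\sqrt t\,r,\frac12+u)$, and the conclusion of 2 on the answers holds for the attack with simulated noise and this honest law. In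 $n$ rounds with arbitrary challenges $(\theta_i,r_i,r_i^\perp)$ and a fresh ideal pair in each round, given that the outcomes $(m_x,m_p)$ lie in arbitrary measurable windows $D_i$ of positive finite area, the joint law of all answers equals the honest one. In particular the probability of passing the verifiers' checks on the answers is exactly that of the honest prover. 4. With a two-mode squeezed vacuum of finite $\zeta\ge0$ instead of the ideal pair, both answers equal one sample of $\mathcal N(\sqrt t\,r,\frac12+u+te^{-2\zeta})$, and the law of the answers converges to the honest one in total variation as $\zeta\to\infty$. 5. If, on a line with signal speed 1, $V_1,V_2$ are at $v_1,v_2$ and Alice and Bob sit at $a,b$ with $v_1\le a\le p\le b\le v_2$ and act without delay, their answers reach $V_1$ and $V_2$ exactly when those of an honest prover at $p$ would. -/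

import Mathlib

open MeasureTheory ProbabilityTheory Filter Topology
open scoped NNReal ENNReal

noncomputable section

namespace CVQPV

/-! ### Phase space, Wigner functions and states -/

/-- The phase space of one mode; a point is `(x, p)`. -/
abbrev Mode : Type := ℝ × ℝ

/-- The Wigner function of the `N`-mode Gaussian state with covariance matrix `Γ` and displacement
vector `d`; the coordinates are ordered as `(x₁, p₁, …, x_N, p_N)`. -/
def gaussianWigner (N : ℕ) (Γ : Matrix (Fin (2 * N)) (Fin (2 * N)) ℝ) (d r : Fin (2 * N) → ℝ) : ℝ :=
  1 / (Real.pi ^ N * √Γ.det) * Real.exp (-((r - d) ⬝ᵥ (Γ⁻¹.mulVec (r - d))))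

/-- The Wigner function `W(x,p) = π⁻¹ ∫ e^{2ipy} ⟨x-y|ψ⟩⟨ψ|x+y⟩ dy` of a one-mode pure state with
wave function `ψ`. (The integral is real; `re` only changes the type.) -/
def wignerTransform (ψ : ℝ → ℂ) (z : Mode) : ℝ :=
  ((1 / Real.pi : ℂ) * ∫ y : ℝ,
    Complex.exp (2 * Complex.I * z.2 * y) * ψ (z.1 - y) * (starRingEnd ℂ) (ψ (z.1 + y))).re

/-- The wave function of the coherent state with quadratures `z₀ = (x₀, p₀)` (up to a global
phase), in units where the vacuum is `π^{-1/4} e^{-x²/2}`. -/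
def coherentWave (z₀ : Mode) (x : ℝ) : ℂ :=
  ((Real.pi ^ (-(1 / 4) : ℝ) : ℝ) : ℂ) *
    Complex.exp (-((x : ℂ) - z₀.1) ^ 2 / 2 + Complex.I * z₀.2 * x)

/-! All states below have a nonnegative Wigner function (or distribution) and are represented by
the corresponding measure `W dx dp` on phase space. -/

/-- The coherent state with quadratures `z₀`. -/
def coherentState (z₀ : Mode) : Measure Mode :=
  volume.withDensity fun z => ENNReal.ofReal (wignerTransform (coherentWave z₀) z)

/-- The coherent state with quadratures `z₀` after a channel with attenuation `t` and excess noise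
power `u`: displacement `√t z₀`, covariance matrix `(1 + 2u) 𝟙₂`. -/
def noisyCoherentState (t u : ℝ) (z₀ : Mode) : Measure Mode :=
  volume.withDensity fun z => ENNReal.ofReal
    (gaussianWigner 1 ((1 + 2 * u) • (1 : Matrix (Fin 2) (Fin 2) ℝ))
      ![√t * z₀.1, √t * z₀.2] ![z.1, z.2])

/-- Covariance matrix of the two-mode squeezed vacuum with squeezing parameter `ζ`. -/
def tmsvCov (ζ : ℝ) : Matrix (Fin 4) (Fin 4) ℝ :=
  !![Real.cosh (2 * ζ), 0, Real.sinh (2 * ζ), 0;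
     0, Real.cosh (2 * ζ), 0, -Real.sinh (2 * ζ);
     Real.sinh (2 * ζ), 0, Real.cosh (2 * ζ), 0;
     0, -Real.sinh (2 * ζ), 0, Real.cosh (2 * ζ)]

/-- The two-mode squeezed vacuum on the modes `(A, B)`. -/
def tmsvState (ζ : ℝ) : Measure (Mode × Mode) :=
  volume.withDensity fun z => ENNReal.ofReal
    (gaussianWigner 2 (tmsvCov ζ) 0 ![z.1.1, z.1.2, z.2.1, z.2.2])

/-- The ideal EPR pair on the modes `(A, B)`, with Wigner distribution
`C δ(x_a - x_b) δ(p_a + p_b)`. It is not normalizable: its total mass is infinite. -/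
def idealEPR (C : ℝ) : Measure (Mode × Mode) :=
  ENNReal.ofReal C • (volume : Measure Mode).map fun z => (z, (z.1, -z.2))

/-! ### Measurements -/

/-- The quadrature `x_θ` in the direction `θ`. -/
def quadrature (θ : ℝ) (z : Mode) : ℝ := z.1 * Real.cos θ + z.2 * Real.sin θ

/-- Outcome distribution of a homodyne measurement under angle `θ`: the marginal of the Wigner
distribution along `x_θ`. -/
def homodyne (θ : ℝ) (ρ : Measure Mode) : Measure ℝ := ρ.map (quadrature θ)

/-- The balanced beamsplitter, acting on the phase space of two modes. -/
def beamSplitter (z : Mode × Mode) : Mode × Mode :=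
  (√(1 / 2) • (z.1 + z.2), √(1 / 2) • (-z.1 + z.2))

/-- Teleportation without the final correction. The mode in state `ψ` is mixed with the `A` mode
of the pair; `p` is measured in the first output mode and `x` in the second. The result is the
joint distribution of the outcome `m = (m_x, m_p)` and of the `B` mode. -/
def teleport (ψ : Measure Mode) (epr : Measure (Mode × Mode)) : Measure ((ℝ × ℝ) × Mode) :=
  (ψ.prod epr).map fun w =>
    (((beamSplitter (w.1, w.2.1)).2.1, (beamSplitter (w.1, w.2.1)).1.2), w.2.2)

/-- The displacement `(d_x, d_p)` that the outcome `m` induces on the `B` mode. -/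
def displacement (m : ℝ × ℝ) : Mode := (√2 * m.1, -√2 * m.2)

/-! ### The protocol and the attack -/

/-- Quadratures of the coherent state prepared for the challenge `(θ, r, r⊥)`. -/
def challenge (θ r rp : ℝ) : Mode :=
  (r * Real.cos θ + rp * Real.sin θ, r * Real.sin θ - rp * Real.cos θ)

/-- The prover sends one value to both verifiers. -/
def toBoth (a : ℝ) : ℝ × ℝ := (a, a)

/-- Joint distribution of the outcome `m` of Alice (who teleports `ψ`) and of the outcome `μ` of
Bob (who homodynes his half of the pair under `θ`). -/
def attackOutcomes (ψ : Measure Mode) (epr : Measure (Mode × Mode)) (θ : ℝ) :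
    Measure ((ℝ × ℝ) × ℝ) :=
  (teleport ψ epr).map fun w => (w.1, quadrature θ w.2)

/-- Alice's answer to `V₁`: from her own outcome `m` and Bob's message `(θ, μ)`. -/
def aliceAnswer (m : ℝ × ℝ) (msg : ℝ × ℝ) : ℝ :=
  msg.2 - (displacement m).1 * Real.cos msg.1 - (displacement m).2 * Real.sin msg.1

/-- Bob's answer to `V₂`: from his own data `(θ, μ)` and Alice's message `(d_x, d_p)`. -/
def bobAnswer (own : ℝ × ℝ) (d : ℝ × ℝ) : ℝ :=
  own.2 - d.1 * Real.cos own.1 - d.2 * Real.sin own.1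

/-- Joint distribution of Alice's outcome `m` and of the two answers. -/
def attackRound (ψ : Measure Mode) (epr : Measure (Mode × Mode)) (θ : ℝ) :
    Measure ((ℝ × ℝ) × (ℝ × ℝ)) :=
  (attackOutcomes ψ epr θ).map fun w =>
    (w.1, (aliceAnswer w.1 (θ, w.2), bobAnswer (θ, w.2) (displacement w.1)))

/-- The same attack with simulated channel noise: one of the attackers draws an independent
`ξ ~ N(0, (1-t)/2 + u)` and forwards it with the other data; both report `√t r' + ξ`. -/
def noisyAttackRound (t u : ℝ) (ψ : Measure Mode) (epr : Measure (Mode × Mode)) (θ : ℝ) :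
    Measure ((ℝ × ℝ) × (ℝ × ℝ)) :=
  ((attackRound ψ epr θ).prod (gaussianReal 0 (Real.toNNReal ((1 - t) / 2 + u)))).map fun w =>
    (w.1.1, (√t * w.1.2.1 + w.2, √t * w.1.2.2 + w.2))

/-- The law of the two answers, given that Alice's outcome lies in the window `D`. -/
def answersGiven (M : Measure ((ℝ × ℝ) × (ℝ × ℝ))) (D : Set (ℝ × ℝ)) : Measure (ℝ × ℝ) :=
  (ProbabilityTheory.cond M (Prod.fst ⁻¹' D)).map Prod.snd

/-- The threshold `γ` for the score. -/
def threshold (n : ℕ) (ε : ℝ) : ℝ :=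
  1 + 2 / √n * √(Real.log (1 / ε)) + 2 / n * Real.log (1 / ε)

/-- The answers `(a i).1` to `V₁` and `(a i).2` to `V₂` that the verifiers accept (apart from
timing): the two verifiers hear the same value in each round, and the score is below `γ`. -/
def accepted (n : ℕ) (t u ε : ℝ) (r : Fin n → ℝ) : Set (Fin n → ℝ × ℝ) :=
  {a | (∀ i, (a i).1 = (a i).2) ∧
    1 / (n : ℝ) * ∑ i, ((a i).1 - r i * √t) ^ 2 / (1 / 2 + u) < threshold n ε}

/-! ### Timing (on a line, signal speed 1) -/

/-- Arrival time at `y` of a signal sent from `x` at time `s`. -/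
def arrival (s x y : ℝ) : ℝ := s + |y - x|

/-- Time at which a signal sent by the verifier at `v` towards the prover position `p`, timed so as
to arrive there at time `T`, passes the position `y`. -/
def intercept (T v p y : ℝ) : ℝ := arrival (T - |p - v|) v y

/-- Arrival time at the verifier `v` of the answer of an attacker sitting at `a`, whose accomplice
sits at `b`. The attacker intercepts the signal of `v`, the accomplice that of the other verifier
`v'`; each forwards classical data to the other at once. -/
def attackArrival (T v v' p a b : ℝ) : ℝ :=
  arrival (max (intercept T v p a) (arrival (intercept T v' p b) b a)) a v

end CVQPV

end

/-!
Write `z`, `a`, `b` for the phase-space points of the intercepted mode and of the modes `A`, `B`.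
Alice's displacement is `d = a* - z`, where `a* = (x, -p)` for `a = (x, p)`, so both answers
`quadrature θ (b - d)` equal `quadrature θ (z + (b - a*))`: the quadrature an honest prover would
have measured plus that of the error `b - a*` of the pair. For the ideal pair the error vanishes
and `a` is uniform, which makes Alice's outcome uniform and independent of the input. The two-mode
squeezed vacuum is, in the coordinates `q = (a* + b) / 2` and `s = b - a*`, a product of isotropic
Gaussians of variances `e^{2ζ} / 4` and `e^{-2ζ}`; the error `s` thus adds the variance
`t e^{-2ζ}` to the answers. As `ζ → ∞`, `s` concentrates at `0` and the law of `q`, rescaled by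
`(π / 2) e^{2ζ}`, spreads out to Lebesgue measure.
-/

namespace CVQPV

section TotalVariation

variable {α ι : Type*} [MeasurableSpace α] {μ : Measure α} {l : Filter ι}

-- Scheffé: `|f - g| = 2 (g - f)⁺ + (f - g)`, and `(g - f)⁺` is dominated by `|g|` as `0 ≤ f`.
theorem tendsto_integral_abs_sub_of_tendsto_integral [l.IsCountablyGenerated]
    {f : ι → α → ℝ} {g : α → ℝ} (hf : ∀ i, Integrable (f i) μ) (hf₀ : ∀ i x, 0 ≤ f i x)
    (hg : Integrable g μ) (hfg : ∀ᵐ x ∂μ, Tendsto (fun i => f i x) l (𝓝 (g x)))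
    (hint : Tendsto (fun i => ∫ x, f i x ∂μ) l (𝓝 (∫ x, g x ∂μ))) :
    Tendsto (fun i => ∫ x, |f i x - g x| ∂μ) l (𝓝 0) := by
  have hpos : Tendsto (fun i => ∫ x, max (g x - f i x) 0 ∂μ) l (𝓝 (∫ _, (0 : ℝ) ∂μ)) := by
    refine tendsto_integral_filter_of_dominated_convergence (fun x => |g x|)
      (.of_forall fun i => (hg.sub (hf i)).pos_part.aestronglyMeasurable)
      (.of_forall fun i => .of_forall fun x => ?_) hg.abs ?_
    · rw [Real.norm_of_nonneg (le_max_right _ _)]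
      exact max_le (by linarith [le_abs_self (g x), hf₀ i x]) (abs_nonneg _)
    · filter_upwards [hfg] with x hx
      simpa using (hx.const_sub (g x)).max (tendsto_const_nhds (x := (0 : ℝ)))
  have hsplit (i : ι) : ∫ x, |f i x - g x| ∂μ =
      2 * ∫ x, max (g x - f i x) 0 ∂μ + (∫ x, f i x ∂μ - ∫ x, g x ∂μ) := by
    rw [← integral_const_mul, ← integral_sub (hf i) hg,
      ← integral_add (f := fun x => 2 * max (g x - f i x) 0) (g := fun x => f i x - g x)
        ((hg.sub (hf i)).pos_part.const_mul 2) ((hf i).sub hg)]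
    refine integral_congr_ae (.of_forall fun x => ?_)
    dsimp only
    rcases le_total (f i x) (g x) with h | h
    · rw [abs_of_nonpos (sub_nonpos.2 h), max_eq_left (sub_nonneg.2 h)]
      ring
    · rw [abs_of_nonneg (sub_nonneg.2 h), max_eq_right (sub_nonpos.2 h)]
      ring
  simpa [hsplit] using (hpos.const_mul 2).add (hint.sub_const (∫ x, g x ∂μ))

theorem abs_setIntegral_sub_setIntegral_le {f g : α → ℝ} (hf : Integrable f μ)
    (hg : Integrable g μ) (s : Set α) :
    |∫ x in s, f x ∂μ - ∫ x in s, g x ∂μ| ≤ ∫ x, |f x - g x| ∂μ := by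
  rw [← integral_sub hf.integrableOn hg.integrableOn]
  exact abs_integral_le_integral_abs.trans
    (setIntegral_le_integral (hf.sub hg).abs (.of_forall fun x => abs_nonneg _))

theorem gaussianReal_real_eq_setIntegral (m : ℝ) {v : ℝ≥0} (hv : v ≠ 0) (s : Set ℝ) :
    (gaussianReal m v).real s = ∫ x in s, gaussianPDFReal m v x := by
  rw [Measure.real, gaussianReal_apply_eq_integral _ hv, ENNReal.toReal_ofReal]
  exact integral_nonneg fun x => gaussianPDFReal_nonneg _ _ _

theorem tendsto_gaussianPDFReal {m : ι → ℝ} {m₀ : ℝ} {v : ι → ℝ≥0} {v₀ : ℝ≥0} (hv₀ : v₀ ≠ 0)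
    (hm : Tendsto m l (𝓝 m₀)) (hv : Tendsto v l (𝓝 v₀)) (x : ℝ) :
    Tendsto (fun i => gaussianPDFReal (m i) (v i) x) l (𝓝 (gaussianPDFReal m₀ v₀ x)) := by
  have hvR : Tendsto (fun i => (v i : ℝ)) l (𝓝 (v₀ : ℝ)) := NNReal.tendsto_coe.2 hv
  unfold gaussianPDFReal
  exact ((hvR.const_mul _).sqrt.inv₀ (by positivity)).mul
    (((hm.const_sub x).pow 2).neg.div (hvR.const_mul 2) (by positivity)).rexp

theorem eventually_abs_gaussianReal_real_sub_le [l.IsCountablyGenerated] {m : ι → ℝ} {m₀ : ℝ}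
    {v : ι → ℝ≥0} {v₀ : ℝ≥0} (hv₀ : v₀ ≠ 0) (hm : Tendsto m l (𝓝 m₀)) (hv : Tendsto v l (𝓝 v₀))
    {δ : ℝ} (hδ : 0 < δ) :
    ∀ᶠ i in l, ∀ s : Set ℝ,
      |(gaussianReal (m i) (v i)).real s - (gaussianReal m₀ v₀).real s| ≤ δ := by
  have hv_ne : ∀ᶠ i in l, v i ≠ 0 := hv.eventually_ne hv₀
  have hmass : Tendsto (fun i => ∫ x, gaussianPDFReal (m i) (v i) x) l
      (𝓝 (∫ x, gaussianPDFReal m₀ v₀ x)) := by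
    rw [integral_gaussianPDFReal_eq_one _ hv₀]
    refine tendsto_const_nhds.congr' ?_
    filter_upwards [hv_ne] with i hi
    rw [integral_gaussianPDFReal_eq_one _ hi]
  have hL1 := tendsto_integral_abs_sub_of_tendsto_integral
    (fun i => integrable_gaussianPDFReal (m i) (v i)) (fun i => gaussianPDFReal_nonneg (m i) (v i))
    (integrable_gaussianPDFReal m₀ v₀) (.of_forall (tendsto_gaussianPDFReal hv₀ hm hv)) hmass
  filter_upwards [hv_ne, hL1.eventually (eventually_le_nhds hδ)] with i hi hle s
  rw [gaussianReal_real_eq_setIntegral _ hi, gaussianReal_real_eq_setIntegral _ hv₀]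
  exact (abs_setIntegral_sub_setIntegral_le (integrable_gaussianPDFReal _ _)
    (integrable_gaussianPDFReal _ _) s).trans hle

end TotalVariation

section IsotropicGaussian

theorem map_linearCombination_gaussianReal (m₁ m₂ a b : ℝ) (v₁ v₂ : ℝ≥0) :
    ((gaussianReal m₁ v₁).prod (gaussianReal m₂ v₂)).map (fun z => a * z.1 + b * z.2) =
      gaussianReal (a * m₁ + b * m₂) (Real.toNNReal (a ^ 2 * v₁ + b ^ 2 * v₂)) := by
  calc ((gaussianReal m₁ v₁).prod (gaussianReal m₂ v₂)).map (fun z => a * z.1 + b * z.2)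
      = (((gaussianReal m₁ v₁).map (a * ·)).prod ((gaussianReal m₂ v₂).map (b * ·))).map
          (fun z => z.1 + z.2) := by
        rw [Measure.map_prod_map _ _ (by fun_prop) (by fun_prop),
          Measure.map_map (by fun_prop) (by fun_prop)]
        rfl
    _ = Measure.conv (gaussianReal (a * m₁) (.mk (a ^ 2) (sq_nonneg a) * v₁))
          (gaussianReal (b * m₂) (.mk (b ^ 2) (sq_nonneg b) * v₂)) := by
        rw [gaussianReal_map_const_mul, gaussianReal_map_const_mul]
        rfl
    _ = gaussianReal (a * m₁ + b * m₂) (Real.toNNReal (a ^ 2 * v₁ + b ^ 2 * v₂)) := by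
        rw [gaussianReal_conv_gaussianReal]
        congr 1
        apply NNReal.eq
        rw [Real.coe_toNNReal _ (by positivity)]
        rfl

/-- The Gaussian measure on the phase space of one mode with mean `m` and covariance `v 𝟙`.
A covariance matrix `γ` in the normalization of `gaussianWigner` corresponds to the covariance
`γ / 2` of quadrature outcomes, so that the vacuum has `v = 1 / 2`. -/
noncomputable def isotropicGaussian (m : Mode) (v : ℝ≥0) : Measure Mode :=
  (gaussianReal m.1 v).prod (gaussianReal m.2 v)

/-- The density of `isotropicGaussian m v` for `v ≠ 0`. -/
noncomputable def isotropicPDF (m : Mode) (v : ℝ≥0) (z : Mode) : ℝ :=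
  gaussianPDFReal m.1 v z.1 * gaussianPDFReal m.2 v z.2

variable (m : Mode) (v : ℝ≥0)

instance isProbabilityMeasure_isotropicGaussian : IsProbabilityMeasure (isotropicGaussian m v) := by
  unfold isotropicGaussian
  infer_instance

theorem isotropicPDF_nonneg (z : Mode) : 0 ≤ isotropicPDF m v z :=
  mul_nonneg (gaussianPDFReal_nonneg _ _ _) (gaussianPDFReal_nonneg _ _ _)

@[fun_prop]
theorem measurable_isotropicPDF : Measurable (isotropicPDF m v) := by
  unfold isotropicPDF
  fun_prop

theorem isotropicPDF_eq (z : Mode) :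
    isotropicPDF m v z =
      (2 * Real.pi * v)⁻¹ * Real.exp (-((z.1 - m.1) ^ 2 + (z.2 - m.2) ^ 2) / (2 * v)) := by
  rw [isotropicPDF, gaussianPDFReal, gaussianPDFReal, mul_mul_mul_comm, ← mul_inv,
    Real.mul_self_sqrt (by positivity), ← Real.exp_add, neg_add, add_div]

theorem isotropicGaussian_eq_withDensity {v : ℝ≥0} (hv : v ≠ 0) :
    isotropicGaussian m v = volume.withDensity fun z => ENNReal.ofReal (isotropicPDF m v z) := by
  rw [isotropicGaussian, gaussianReal_of_var_ne_zero _ hv, gaussianReal_of_var_ne_zero _ hv,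
    prod_withDensity (measurable_gaussianPDF _ _) (measurable_gaussianPDF _ _),
    ← Measure.volume_eq_prod]
  simp only [isotropicPDF, gaussianPDF, ENNReal.ofReal_mul (gaussianPDFReal_nonneg _ _ _)]

theorem homodyne_isotropicGaussian (θ : ℝ) :
    homodyne θ (isotropicGaussian m v) = gaussianReal (quadrature θ m) v := by
  have hquad : quadrature θ = fun z : Mode => Real.cos θ * z.1 + Real.sin θ * z.2 := by
    funext z
    simp only [quadrature, mul_comm]
  rw [homodyne, isotropicGaussian, hquad, map_linearCombination_gaussianReal, ← add_mul,
    Real.cos_sq_add_sin_sq, one_mul, Real.toNNReal_coe]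

theorem map_add_const_isotropicGaussian (d : Mode) :
    (isotropicGaussian m v).map (· + d) = isotropicGaussian (m + d) v := by
  simp only [isotropicGaussian, Prod.fst_add, Prod.snd_add, ← gaussianReal_map_add_const]
  exact (Measure.map_prod_map _ _ (measurable_add_const _) (measurable_add_const _)).symm

theorem map_const_smul_isotropicGaussian (c : ℝ) :
    (isotropicGaussian m v).map (c • ·) =
      isotropicGaussian (c • m) (.mk (c ^ 2) (sq_nonneg c) * v) := by
  simp only [isotropicGaussian, Prod.smul_fst, Prod.smul_snd, smul_eq_mul,
    ← gaussianReal_map_const_mul]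
  exact (Measure.map_prod_map _ _ (measurable_const_mul c) (measurable_const_mul c)).symm

end IsotropicGaussian

section FlatLimit

theorem exists_norm_le_indicator_fst {X Y E : Type*} [TopologicalSpace X] [TopologicalSpace Y]
    [NormedAddCommGroup E] {g : X × Y → E} (hg : Continuous g) (hc : HasCompactSupport g) :
    ∃ K : Set X, IsCompact K ∧ ∃ M : ℝ, ∀ z, ‖g z‖ ≤ K.indicator (fun _ => M) z.1 := by
  obtain ⟨M, hM⟩ := hc.exists_bound_of_continuous hg
  refine ⟨Prod.fst '' tsupport g, hc.isCompact.image continuous_fst, M, fun z => ?_⟩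
  by_cases hz : z ∈ tsupport g
  · rw [Set.indicator_of_mem (Set.mem_image_of_mem _ hz)]
    exact hM z
  · rw [image_eq_zero_of_notMem_tsupport hz, norm_zero]
    exact Set.indicator_nonneg (fun _ _ => (norm_nonneg _).trans (hM z)) _

theorem mul_integral_prod_isotropicGaussian {v : ℝ≥0} (hv : v ≠ 0) (w : ℝ≥0)
    {g : Mode × Mode → ℝ} (hg : Continuous g) :
    2 * Real.pi * v * ∫ z, g z ∂((isotropicGaussian 0 v).prod (isotropicGaussian 0 w)) =
      ∫ z : Mode × Mode, Real.exp (-(z.1.1 ^ 2 + z.1.2 ^ 2) / (2 * v)) * g (z.1, √(w : ℝ) • z.2)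
        ∂((volume : Measure Mode).prod (isotropicGaussian 0 1)) := by
  have hscale : isotropicGaussian 0 w = (isotropicGaussian 0 1).map (√(w : ℝ) • ·) := by
    rw [map_const_smul_isotropicGaussian, smul_zero, mul_one]
    congr 1
    exact NNReal.eq (Real.sq_sqrt w.2).symm
  have hid : (isotropicGaussian 0 v).map id = isotropicGaussian 0 v := Measure.map_id
  have hpdf (q : Mode) : 2 * Real.pi * v * isotropicPDF 0 v q =
      Real.exp (-(q.1 ^ 2 + q.2 ^ 2) / (2 * v)) := by
    rw [isotropicPDF_eq, mul_inv_cancel_left₀ (by positivity), Prod.fst_zero, Prod.snd_zero,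
      sub_zero, sub_zero]
  rw [hscale, ← hid, Measure.map_prod_map _ _ measurable_id (measurable_const_smul _),
    integral_map (by fun_prop) (by fun_prop), isotropicGaussian_eq_withDensity 0 hv,
    prod_withDensity_left (by fun_prop), integral_withDensity_eq_integral_toReal_smul
      (by fun_prop) (.of_forall fun _ => ENNReal.ofReal_lt_top), ← integral_const_mul]
  refine integral_congr_ae (.of_forall fun z => ?_)
  dsimp only
  rw [ENNReal.toReal_ofReal (isotropicPDF_nonneg _ _ _), smul_eq_mul, ← mul_assoc, hpdf]
  rfl

theorem tendsto_mul_integral_prod_isotropicGaussian {ι : Type*} {l : Filter ι}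
    [l.IsCountablyGenerated] {v w : ι → ℝ≥0} (hv : Tendsto v l atTop) (hw : Tendsto w l (𝓝 0))
    {g : Mode × Mode → ℝ} (hg : Continuous g) (hc : HasCompactSupport g) :
    Tendsto (fun i => 2 * Real.pi * v i *
        ∫ z, g z ∂((isotropicGaussian 0 (v i)).prod (isotropicGaussian 0 (w i)))) l
      (𝓝 (∫ q : Mode, g (q, 0))) := by
  obtain ⟨K, hK, M, hM⟩ := exists_norm_le_indicator_fst hg hc
  have hlimit : ∫ q : Mode, g (q, 0) = ∫ z : Mode × Mode, g (z.1, 0)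
      ∂((volume : Measure Mode).prod (isotropicGaussian 0 1)) := by
    rw [integral_fun_fst fun q : Mode => g (q, 0), probReal_univ, one_smul]
  rw [hlimit]
  refine Tendsto.congr' (f₁ := fun i => ∫ z : Mode × Mode,
      Real.exp (-(z.1.1 ^ 2 + z.1.2 ^ 2) / (2 * v i)) * g (z.1, √(w i : ℝ) • z.2)
        ∂((volume : Measure Mode).prod (isotropicGaussian 0 1))) ?_ ?_
  · filter_upwards [hv.eventually_ne_atTop 0] with i hi
    exact (mul_integral_prod_isotropicGaussian hi (w i) hg).symm
  refine tendsto_integral_filter_of_dominated_convergence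
    (fun z => K.indicator (fun _ => M) z.1 * 1)
    (.of_forall fun i => (by fun_prop : Continuous _).aestronglyMeasurable)
    (.of_forall fun i => .of_forall fun z => ?_) ?_ (.of_forall fun z => ?_)
  · rw [norm_mul, Real.norm_of_nonneg (Real.exp_pos _).le, mul_one]
    refine (mul_le_of_le_one_left (norm_nonneg _) (Real.exp_le_one_iff.2 ?_)).trans (hM _)
    exact div_nonpos_of_nonpos_of_nonneg (neg_nonpos.2 (by positivity)) (by positivity)
  · refine Integrable.mul_prod ?_ (integrable_const (1 : ℝ))
    rw [integrable_indicator_iff hK.measurableSet]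
    exact integrableOn_const hK.measure_lt_top.ne
  · have hvR : Tendsto (fun i => (v i : ℝ)) l atTop := NNReal.tendsto_coe_atTop.2 hv
    have hwR : Tendsto (fun i => √(w i : ℝ) • z.2) l (𝓝 0) := by
      simpa using ((NNReal.tendsto_coe.2 hw).sqrt).smul_const z.2
    have hweight := (hvR.const_mul_atTop (zero_lt_two' ℝ)).const_div_atTop
      (-(z.1.1 ^ 2 + z.1.2 ^ 2))
    simpa using hweight.rexp.mul
      ((hg.tendsto (z.1, 0)).comp (tendsto_const_nhds.prodMk_nhds hwR))

end FlatLimit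

section CoherentStates

theorem quadrature_challenge (θ r rp : ℝ) : quadrature θ (challenge θ r rp) = r := by
  simp only [quadrature, challenge]
  linear_combination r * Real.cos_sq_add_sin_sq θ

theorem quadrature_smul (θ c : ℝ) (z : Mode) : quadrature θ (c • z) = c * quadrature θ z := by
  simp only [quadrature, Prod.smul_fst, Prod.smul_snd, smul_eq_mul]
  ring

theorem integral_cexp_I_mul_cexp_neg_sq (a : ℝ) :
    ∫ y : ℝ, Complex.exp (Complex.I * (2 * a) * y) * Complex.exp (-1 * y ^ 2) =
      ((√Real.pi * Real.exp (-a ^ 2) : ℝ) : ℂ) := by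
  rw [fourierIntegral_gaussian (b := 1) (by simp) (2 * a : ℂ), div_one, Real.sqrt_eq_rpow,
    Complex.ofReal_mul, Complex.ofReal_cpow Real.pi_pos.le, Complex.ofReal_exp]
  push_cast
  ring_nf

theorem coherentWave_mul_conj (z₀ : Mode) (x y : ℝ) :
    coherentWave z₀ (x - y) * (starRingEnd ℂ) (coherentWave z₀ (x + y)) =
      (((√Real.pi)⁻¹ * Real.exp (-(x - z₀.1) ^ 2) : ℝ) : ℂ) *
        (Complex.exp (-(2 * Complex.I * z₀.2 * y)) * Complex.exp (-1 * y ^ 2)) := by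
  have hnorm : Real.pi ^ (-(1 / 4) : ℝ) * Real.pi ^ (-(1 / 4) : ℝ) = (√Real.pi)⁻¹ := by
    rw [← Real.rpow_add Real.pi_pos, Real.sqrt_eq_rpow, ← Real.rpow_neg Real.pi_pos.le]
    norm_num
  rw [← hnorm]
  simp only [coherentWave, map_mul, Complex.conj_ofReal, ← Complex.exp_conj, Complex.ofReal_mul,
    Complex.ofReal_exp]
  rw [mul_mul_mul_comm, mul_assoc (_ * _ : ℂ), ← Complex.exp_add, ← Complex.exp_add,
    ← Complex.exp_add]
  congr 2
  simp only [map_add, map_div₀, map_neg, map_pow, map_sub, map_mul, Complex.conj_ofReal,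
    Complex.conj_I, Complex.conj_ofNat]
  push_cast
  ring

theorem wignerTransform_coherentWave (z₀ z : Mode) :
    wignerTransform (coherentWave z₀) z = isotropicPDF z₀ (1 / 2) z := by
  have hintegrand (y : ℝ) :
      Complex.exp (2 * Complex.I * z.2 * y) * coherentWave z₀ (z.1 - y) *
          (starRingEnd ℂ) (coherentWave z₀ (z.1 + y)) =
        (((√Real.pi)⁻¹ * Real.exp (-(z.1 - z₀.1) ^ 2) : ℝ) : ℂ) *
          (Complex.exp (Complex.I * (2 * (z.2 - z₀.2 : ℝ)) * y) *
            Complex.exp (-1 * y ^ 2)) := by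
    rw [mul_assoc, coherentWave_mul_conj, mul_left_comm, ← mul_assoc (Complex.exp _),
      ← Complex.exp_add]
    push_cast
    ring_nf
  have hπ : √Real.pi ≠ 0 := by positivity
  rw [wignerTransform, integral_congr_ae (.of_forall hintegrand), integral_const_mul,
    integral_cexp_I_mul_cexp_neg_sq, isotropicPDF_eq]
  norm_cast
  rw [mul_mul_mul_comm, inv_mul_cancel₀ hπ, ← Real.exp_add]
  push_cast
  ring_nf

theorem coherentState_eq (z₀ : Mode) : coherentState z₀ = isotropicGaussian z₀ (1 / 2) := by
  rw [isotropicGaussian_eq_withDensity _ (by norm_num), coherentState]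
  simp only [wignerTransform_coherentWave]

instance isProbabilityMeasure_coherentState (z₀ : Mode) :
    IsProbabilityMeasure (coherentState z₀) := by
  rw [coherentState_eq]
  infer_instance

theorem gaussianWigner_smul_one (N : ℕ) {c : ℝ} (hc : 0 < c) (d r : Fin (2 * N) → ℝ) :
    gaussianWigner N (c • 1) d r =
      ((Real.pi * c) ^ N)⁻¹ * Real.exp (-(∑ i, (r i - d i) ^ 2) / c) := by
  have hdet : √(c • (1 : Matrix (Fin (2 * N)) (Fin (2 * N)) ℝ)).det = c ^ N := by
    rw [Matrix.det_smul, Matrix.det_one, mul_one, Fintype.card_fin, pow_mul',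
      Real.sqrt_sq (by positivity)]
  have hinv : (c • (1 : Matrix (Fin (2 * N)) (Fin (2 * N)) ℝ))⁻¹ = c⁻¹ • 1 := by
    refine Matrix.inv_eq_right_inv ?_
    rw [smul_mul_smul_comm, mul_inv_cancel₀ hc.ne', one_smul, mul_one]
  rw [gaussianWigner, hdet, hinv, Matrix.smul_mulVec, Matrix.one_mulVec, dotProduct_smul,
    smul_eq_mul, one_div, ← mul_pow, neg_div, div_eq_inv_mul]
  simp only [dotProduct, Pi.sub_apply, sq]

theorem noisyCoherentState_eq (t : ℝ) {u : ℝ} (hu : 0 < 1 + 2 * u) (z₀ : Mode) :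
    noisyCoherentState t u z₀ = isotropicGaussian (√t • z₀) (Real.toNNReal (1 / 2 + u)) := by
  have hv : 0 < 1 / 2 + u := by linarith
  rw [isotropicGaussian_eq_withDensity _ (Real.toNNReal_pos.2 hv).ne', noisyCoherentState]
  congr! with z
  rw [gaussianWigner_smul_one 1 hu, isotropicPDF_eq, Real.coe_toNNReal _ hv.le, pow_one,
    Fin.sum_univ_two]
  simp only [Matrix.cons_val_zero, Matrix.cons_val_one, Prod.smul_fst, Prod.smul_snd, smul_eq_mul]
  ring_nf

theorem homodyne_coherentState (θ : ℝ) (z₀ : Mode) :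
    homodyne θ (coherentState z₀) = gaussianReal (quadrature θ z₀) (1 / 2) := by
  rw [coherentState_eq, homodyne_isotropicGaussian]

theorem homodyne_noisyCoherentState (t : ℝ) {u : ℝ} (hu : 0 < 1 + 2 * u) (θ : ℝ) (z₀ : Mode) :
    homodyne θ (noisyCoherentState t u z₀) =
      gaussianReal (√t * quadrature θ z₀) (Real.toNNReal (1 / 2 + u)) := by
  rw [noisyCoherentState_eq t hu, homodyne_isotropicGaussian, quadrature_smul]

end CoherentStates

section Teleportation

@[fun_prop]
theorem measurable_quadrature (θ : ℝ) : Measurable (quadrature θ) := by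
  unfold quadrature
  fun_prop

@[fun_prop]
theorem measurable_displacement : Measurable displacement := by
  unfold displacement
  fun_prop

@[fun_prop]
theorem measurable_toBoth : Measurable toBoth := by
  unfold toBoth
  fun_prop

theorem quadrature_add (θ : ℝ) (z w : Mode) :
    quadrature θ (z + w) = quadrature θ z + quadrature θ w := by
  simp only [quadrature, Prod.fst_add, Prod.snd_add]
  ring

/-- Phase conjugation `(x, p) ↦ (x, -p)`, which relates the two modes of an ideal EPR pair. -/
def phaseConj (z : Mode) : Mode := (z.1, -z.2)

@[fun_prop]
theorem continuous_phaseConj : Continuous phaseConj := by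
  unfold phaseConj
  fun_prop

theorem measurePreserving_phaseConj : MeasurePreserving phaseConj volume volume :=
  (MeasurePreserving.id volume).prod (Measure.measurePreserving_neg (volume : Measure ℝ))

/-- Alice's outcome `(m_x, m_p)` when the intercepted mode is at the phase-space point `z` and her
half of the pair at `a`. -/
noncomputable def bellOutcome (z a : Mode) : ℝ × ℝ :=
  ((beamSplitter (z, a)).2.1, (beamSplitter (z, a)).1.2)

/-- The deviation of a pair of modes from the ideal EPR correlations. -/
def correlationError (w : Mode × Mode) : Mode := w.2 - phaseConj w.1

@[fun_prop]
theorem measurable_correlationError : Measurable correlationError := by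
  unfold correlationError
  fun_prop

theorem bellOutcome_eq (z a : Mode) :
    bellOutcome z a = (√(1 / 2) * (-z.1 + a.1), √(1 / 2) * (z.2 + a.2)) := rfl

@[fun_prop]
theorem measurable_bellOutcome : Measurable fun w : Mode × Mode => bellOutcome w.1 w.2 := by
  simp only [bellOutcome_eq]
  fun_prop

theorem displacement_bellOutcome (z a : Mode) :
    displacement (bellOutcome z a) = phaseConj a - z := by
  have hcancel (x : ℝ) : √2 * (√(1 / 2) * x) = x := by
    rw [← mul_assoc, ← Real.sqrt_mul zero_le_two, mul_one_div_cancel two_ne_zero, Real.sqrt_one,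
      one_mul]
  rw [bellOutcome_eq, displacement, neg_mul, hcancel, hcancel]
  ext <;> simp only [phaseConj, Prod.fst_sub, Prod.snd_sub] <;> ring

theorem map_bellOutcome (z : Mode) :
    (volume : Measure Mode).map (bellOutcome z) = (2 : ℝ≥0∞) • volume := by
  have hc : √(1 / 2 : ℝ) ≠ 0 := by positivity
  have haff (x : ℝ) : (volume : Measure ℝ).map (fun y => √(1 / 2) * (x + y)) =
      ENNReal.ofReal |(√(1 / 2))⁻¹| • volume := by
    rw [← Real.map_volume_mul_left hc]
    conv_rhs => rw [← map_add_left_eq_self volume x, Measure.map_map (by fun_prop) (by fun_prop)]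
    rfl
  calc (volume : Measure Mode).map (bellOutcome z)
      = ((volume : Measure ℝ).map fun y => √(1 / 2) * (-z.1 + y)).prod
          ((volume : Measure ℝ).map fun y => √(1 / 2) * (z.2 + y)) := by
        rw [Measure.map_prod_map _ _ (by fun_prop) (by fun_prop)]
        rfl
    _ = (2 : ℝ≥0∞) • volume := by
        rw [haff, haff, Measure.prod_smul_left, Measure.prod_smul_right, smul_smul,
          ← ENNReal.ofReal_mul (abs_nonneg _), ← abs_mul, ← mul_inv,
          Real.mul_self_sqrt (by norm_num), ← Measure.volume_eq_prod]
        norm_num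

instance sFinite_idealEPR (C : ℝ) : SFinite (idealEPR C) := by
  unfold idealEPR
  infer_instance

instance sFinite_homodyne (ψ : Measure Mode) [SFinite ψ] (θ : ℝ) : SFinite (homodyne θ ψ) := by
  unfold homodyne
  infer_instance

theorem prod_idealEPR (ψ : Measure Mode) [SFinite ψ] (C : ℝ) :
    ψ.prod (idealEPR C) = ENNReal.ofReal C •
      (ψ.prod volume).map fun w => (w.1, (w.2, phaseConj w.2)) := by
  rw [idealEPR, Measure.prod_smul_right]
  congr 1
  calc ψ.prod ((volume : Measure Mode).map fun z => (z, phaseConj z))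
      = (ψ.map id).prod ((volume : Measure Mode).map fun z => (z, phaseConj z)) := by
        rw [Measure.map_id]
    _ = _ := Measure.map_prod_map _ _ measurable_id (by fun_prop)

theorem teleport_eq (ψ : Measure Mode) (epr : Measure (Mode × Mode)) :
    teleport ψ epr = (ψ.prod epr).map fun w => (bellOutcome w.1 w.2.1, w.2.2) := rfl

theorem map_displacement_teleport_idealEPR (ψ : Measure Mode) [SFinite ψ] (C : ℝ) :
    (teleport ψ (idealEPR C)).map (fun w => (displacement w.1, w.2)) =
      ENNReal.ofReal C • (ψ.prod volume).map fun w => (w.2, w.1 + w.2) := by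
  have hshift : MeasurePreserving (fun w : Mode × Mode => (w.1, -w.1 + phaseConj w.2))
      (ψ.prod volume) (ψ.prod volume) :=
    (MeasurePreserving.id ψ).skew_product (g := fun z a => -z + phaseConj a) (by fun_prop)
      (.of_forall fun z =>
        ((measurePreserving_add_left volume (-z)).comp measurePreserving_phaseConj).map_eq)
  rw [teleport_eq, Measure.map_map (by fun_prop) (by fun_prop), prod_idealEPR, Measure.map_smul,
    Measure.map_map (by fun_prop) (by fun_prop)]
  conv_rhs => rw [← hshift.map_eq, Measure.map_map (by fun_prop) hshift.measurable]
  congr 2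
  funext w
  simp only [Function.comp_apply, displacement_bellOutcome, neg_add_eq_sub, add_sub_cancel]

theorem lintegral_teleport_coherentState (C : ℝ) (z₀ : Mode) {f : Mode × Mode → ℝ≥0∞}
    (hf : Measurable f) :
    ∫⁻ w, f (displacement w.1, w.2) ∂(teleport (coherentState z₀) (idealEPR C)) =
      ENNReal.ofReal C * ∫⁻ d : Mode, ∫⁻ z, f (d, z) ∂(coherentState (z₀ + d)) := by
  calc ∫⁻ w, f (displacement w.1, w.2) ∂(teleport (coherentState z₀) (idealEPR C))
      = ENNReal.ofReal C * ∫⁻ w, f (w.2, w.1 + w.2) ∂((coherentState z₀).prod volume) := by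
        rw [← lintegral_map (g := fun w : (ℝ × ℝ) × Mode => (displacement w.1, w.2)) hf
            (by fun_prop), map_displacement_teleport_idealEPR, lintegral_smul_measure,
          lintegral_map hf (by fun_prop), smul_eq_mul]
    _ = ENNReal.ofReal C * ∫⁻ d : Mode, ∫⁻ z, f (d, z + d) ∂(coherentState z₀) := by
        rw [lintegral_prod_symm _ (by fun_prop)]
    _ = ENNReal.ofReal C * ∫⁻ d : Mode, ∫⁻ z, f (d, z) ∂(coherentState (z₀ + d)) := by
        congr! 3 with d
        rw [coherentState_eq, coherentState_eq, ← map_add_const_isotropicGaussian,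
          lintegral_map (by fun_prop) (by fun_prop)]

end Teleportation

section Attack

/-- The joint law of Alice's outcome and of the answer on which both attackers agree: the quadrature
of the intercepted mode, shifted by that of the correlation error of the pair. -/
noncomputable def answerLaw (ψ : Measure Mode) (epr : Measure (Mode × Mode)) (θ : ℝ) :
    Measure ((ℝ × ℝ) × ℝ) :=
  (ψ.prod epr).map fun w => (bellOutcome w.1 w.2.1, quadrature θ (w.1 + correlationError w.2))

instance sFinite_answerLaw (ψ : Measure Mode) [SFinite ψ] (epr : Measure (Mode × Mode))
    [SFinite epr] (θ : ℝ) : SFinite (answerLaw ψ epr θ) := by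
  unfold answerLaw
  infer_instance

theorem attackRound_eq_map_answerLaw (ψ : Measure Mode) (epr : Measure (Mode × Mode)) (θ : ℝ) :
    attackRound ψ epr θ = (answerLaw ψ epr θ).map (Prod.map id toBoth) := by
  have hanswer : Measurable fun w : (ℝ × ℝ) × ℝ =>
      (w.1, (aliceAnswer w.1 (θ, w.2), bobAnswer (θ, w.2) (displacement w.1))) := by
    unfold aliceAnswer bobAnswer
    fun_prop
  rw [attackRound, attackOutcomes, teleport_eq, answerLaw, Measure.map_map hanswer (by fun_prop),
    Measure.map_map (hanswer.comp (by fun_prop)) (by fun_prop),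
    Measure.map_map (by fun_prop) (by fun_prop)]
  congr 1
  funext w
  simp only [Function.comp_apply, Prod.map_apply, id_eq, toBoth, aliceAnswer, bobAnswer,
    displacement_bellOutcome, quadrature, correlationError, Prod.fst_add, Prod.snd_add,
    Prod.fst_sub, Prod.snd_sub]
  ring_nf

theorem answerLaw_idealEPR (ψ : Measure Mode) [SFinite ψ] (C θ : ℝ) :
    answerLaw ψ (idealEPR C) θ =
      (ENNReal.ofReal (2 * C) • (volume : Measure (ℝ × ℝ))).prod (homodyne θ ψ) := by
  have huniform : MeasurePreserving (fun w : Mode × Mode => (quadrature θ w.1, bellOutcome w.1 w.2))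
      (ψ.prod volume) ((homodyne θ ψ).prod ((2 : ℝ≥0∞) • volume)) :=
    ((measurable_quadrature θ).measurePreserving ψ).skew_product (g := bellOutcome) (by fun_prop)
      (.of_forall map_bellOutcome)
  calc answerLaw ψ (idealEPR C) θ
      = ENNReal.ofReal C •
          (ψ.prod volume).map fun w => (bellOutcome w.1 w.2, quadrature θ w.1) := by
        rw [answerLaw, prod_idealEPR, Measure.map_smul,
          Measure.map_map (by fun_prop) (by fun_prop)]
        simp only [Function.comp_def, correlationError, sub_self, add_zero]
    _ = ENNReal.ofReal C • ((homodyne θ ψ).prod ((2 : ℝ≥0∞) • volume)).map Prod.swap := by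
        rw [← huniform.map_eq, Measure.map_map measurable_swap huniform.measurable]
        rfl
    _ = (ENNReal.ofReal (2 * C) • (volume : Measure (ℝ × ℝ))).prod (homodyne θ ψ) := by
        rw [Measure.prod_swap, Measure.prod_smul_left, Measure.prod_smul_left, smul_smul, mul_comm,
          ENNReal.ofReal_mul zero_le_two, ENNReal.ofReal_ofNat]

theorem attackRound_idealEPR (ψ : Measure Mode) [SFinite ψ] (C θ : ℝ) :
    attackRound ψ (idealEPR C) θ = (ENNReal.ofReal (2 * C) • (volume : Measure (ℝ × ℝ))).prod
      ((homodyne θ ψ).map toBoth) := by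
  rw [attackRound_eq_map_answerLaw, answerLaw_idealEPR,
    ← Measure.map_prod_map _ _ measurable_id measurable_toBoth, Measure.map_id]

theorem map_snd_answerLaw (ψ : Measure Mode) [SFinite ψ] (epr : Measure (Mode × Mode))
    [SFinite epr] (θ : ℝ) :
    (answerLaw ψ epr θ).map Prod.snd =
      Measure.conv (homodyne θ ψ) (homodyne θ (epr.map correlationError)) := by
  rw [answerLaw, Measure.map_map measurable_snd (by fun_prop), homodyne, homodyne,
    Measure.map_map (by fun_prop) (by fun_prop), Measure.conv,
    Measure.map_prod_map _ _ (by fun_prop) (by fun_prop),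
    Measure.map_map (by fun_prop) (by fun_prop)]
  congr 1
  funext w
  exact quadrature_add θ _ _

end Attack

section ChannelNoise

variable (t u : ℝ)

/-- The law of `√t a + ξ`, where `a` has law `ν` and `ξ` is the independent noise
`N(0, (1 - t) / 2 + u)` by which the attackers imitate a channel. -/
noncomputable def addChannelNoise (ν : Measure ℝ) : Measure ℝ :=
  (ν.prod (gaussianReal 0 (Real.toNNReal ((1 - t) / 2 + u)))).map fun w => √t * w.1 + w.2

theorem addChannelNoise_gaussianReal {t u : ℝ} (ht : 0 ≤ t) (htu : t ≤ 1 + 2 * u) (m : ℝ)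
    (v : ℝ≥0) :
    addChannelNoise t u (gaussianReal m v) =
      gaussianReal (√t * m) (Real.toNNReal (t * v + (1 - t) / 2 + u)) := by
  have h := map_linearCombination_gaussianReal m 0 (√t) 1 v (Real.toNNReal ((1 - t) / 2 + u))
  simp only [one_mul, mul_zero, add_zero, one_pow] at h
  rw [addChannelNoise, h, Real.sq_sqrt ht, Real.coe_toNNReal _ (by linarith), add_assoc]

theorem homodyne_noisyCoherentState_eq_addChannelNoise {t u : ℝ} (ht : 0 ≤ t)
    (htu : t ≤ 1 + 2 * u) (hu : 0 < 1 + 2 * u) (θ : ℝ) (z₀ : Mode) :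
    homodyne θ (noisyCoherentState t u z₀) =
      addChannelNoise t u (homodyne θ (coherentState z₀)) := by
  rw [homodyne_noisyCoherentState t hu, homodyne_coherentState,
    addChannelNoise_gaussianReal ht htu]
  congr 2
  push_cast
  ring

theorem noisyAttackRound_eq (ψ : Measure Mode) [SFinite ψ] (epr : Measure (Mode × Mode))
    [SFinite epr] (θ : ℝ) :
    noisyAttackRound t u ψ epr θ =
      ((answerLaw ψ epr θ).prod (gaussianReal 0 (Real.toNNReal ((1 - t) / 2 + u)))).map
        fun w => (w.1.1, toBoth (√t * w.1.2 + w.2)) := by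
  have hid := Measure.map_id (μ := gaussianReal 0 (Real.toNNReal ((1 - t) / 2 + u)))
  rw [noisyAttackRound, attackRound_eq_map_answerLaw]
  nth_rw 1 [← hid]
  rw [Measure.map_prod_map _ _ (by fun_prop) measurable_id,
    Measure.map_map (by fun_prop) (by fun_prop)]
  rfl

theorem noisyAttackRound_idealEPR (ψ : Measure Mode) [SFinite ψ] (C θ : ℝ) :
    noisyAttackRound t u ψ (idealEPR C) θ =
      (ENNReal.ofReal (2 * C) • (volume : Measure (ℝ × ℝ))).prod
        ((addChannelNoise t u (homodyne θ ψ)).map toBoth) := by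
  set μ : Measure (ℝ × ℝ) := ENNReal.ofReal (2 * C) • volume
  have hid : μ.map id = μ := Measure.map_id
  conv_rhs => rw [addChannelNoise, Measure.map_map (by fun_prop) (by fun_prop), ← hid,
    Measure.map_prod_map _ _ measurable_id (by fun_prop), ← Measure.prodAssoc_prod,
    Measure.map_map (by fun_prop) (by fun_prop)]
  rw [noisyAttackRound_eq, answerLaw_idealEPR]
  rfl

theorem map_snd_noisyAttackRound (ψ : Measure Mode) [SFinite ψ] (epr : Measure (Mode × Mode))
    [SFinite epr] (θ : ℝ) :
    (noisyAttackRound t u ψ epr θ).map Prod.snd =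
      (addChannelNoise t u
        (Measure.conv (homodyne θ ψ) (homodyne θ (epr.map correlationError)))).map toBoth := by
  have hid := Measure.map_id (μ := gaussianReal 0 (Real.toNNReal ((1 - t) / 2 + u)))
  conv_rhs => rw [← map_snd_answerLaw, addChannelNoise, ← hid,
    Measure.map_prod_map _ _ measurable_snd measurable_id,
    Measure.map_map (by fun_prop) (by fun_prop), Measure.map_map (by fun_prop) (by fun_prop)]
  rw [noisyAttackRound_eq, Measure.map_map measurable_snd (by fun_prop)]
  rfl

theorem answersGiven_prod (μ : Measure (ℝ × ℝ)) [SFinite μ] (ν : Measure (ℝ × ℝ))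
    [IsProbabilityMeasure ν] {D : Set (ℝ × ℝ)} (h0 : μ D ≠ 0) (htop : μ D ≠ ∞) :
    answersGiven (μ.prod ν) D = ν := by
  rw [answersGiven, ProbabilityTheory.cond, ← Set.prod_univ, Measure.map_smul,
    ← Measure.prod_restrict, Measure.restrict_univ, Measure.map_snd_prod, Measure.prod_prod,
    measure_univ, mul_one, Measure.restrict_apply_univ, smul_smul, ENNReal.inv_mul_cancel h0 htop,
    one_smul]

theorem answersGiven_noisyAttackRound_idealEPR (ψ : Measure Mode) [IsProbabilityMeasure ψ]
    {C : ℝ} (hC : 0 < C) (θ : ℝ) {D : Set (ℝ × ℝ)} (h0 : volume D ≠ 0) (htop : volume D ≠ ∞) :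
    answersGiven (noisyAttackRound t u ψ (idealEPR C) θ) D =
      (addChannelNoise t u (homodyne θ ψ)).map toBoth := by
  have : IsProbabilityMeasure (homodyne θ ψ) :=
    Measure.isProbabilityMeasure_map (measurable_quadrature θ).aemeasurable
  have : IsProbabilityMeasure (addChannelNoise t u (homodyne θ ψ)) :=
    Measure.isProbabilityMeasure_map (by fun_prop)
  have : IsProbabilityMeasure ((addChannelNoise t u (homodyne θ ψ)).map toBoth) :=
    Measure.isProbabilityMeasure_map measurable_toBoth.aemeasurable
  rw [noisyAttackRound_idealEPR, answersGiven_prod]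
  · rw [Measure.smul_apply, smul_eq_mul]
    exact mul_ne_zero (ENNReal.ofReal_pos.2 (by positivity)).ne' h0
  · rw [Measure.smul_apply, smul_eq_mul]
    exact ENNReal.mul_ne_top ENNReal.ofReal_ne_top htop

end ChannelNoise

section TwoModeSqueezedVacuum

theorem det_tmsvCov (ζ : ℝ) : (tmsvCov ζ).det = 1 := by
  have hdet (c s : ℝ) :
      !![c, 0, s, 0; 0, c, 0, -s; s, 0, c, 0; 0, -s, 0, c].det = (c ^ 2 - s ^ 2) ^ 2 := by
    rw [Matrix.det_succ_row_zero]
    simp [Matrix.det_fin_three, Fin.sum_univ_four, Fin.succAbove]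
    ring
  rw [tmsvCov, hdet, Real.cosh_sq_sub_sinh_sq, one_pow]

theorem inv_tmsvCov (ζ : ℝ) : (tmsvCov ζ)⁻¹ = tmsvCov (-ζ) := by
  have hcs := Real.cosh_sq (2 * ζ)
  refine Matrix.inv_eq_right_inv (Matrix.ext fun i j => ?_)
  fin_cases i <;> fin_cases j <;>
    simp [tmsvCov, Matrix.mul_apply, Fin.sum_univ_four] <;> linarith

/-- The pair of modes with midpoint `q` and difference `s` once the mode `A` is phase-conjugated:
the coordinates in which the two-mode squeezed vacuum is a product state. -/
noncomputable def pairOf (w : Mode × Mode) : Mode × Mode :=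
  (phaseConj (w.1 - (1 / 2 : ℝ) • w.2), w.1 + (1 / 2 : ℝ) • w.2)

@[fun_prop]
theorem continuous_pairOf : Continuous pairOf := by
  unfold pairOf
  fun_prop

theorem phaseConj_phaseConj (z : Mode) : phaseConj (phaseConj z) = z := by
  simp only [phaseConj, neg_neg]

theorem correlationError_pairOf (w : Mode × Mode) : correlationError (pairOf w) = w.2 := by
  rw [correlationError, pairOf, phaseConj_phaseConj, add_sub_sub_cancel, ← add_smul, add_halves,
    one_smul]

theorem isClosedEmbedding_pairOf : IsClosedEmbedding pairOf := by
  have hinv : Function.LeftInverse (fun w : Mode × Mode =>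
      ((1 / 2 : ℝ) • (phaseConj w.1 + w.2), correlationError w)) pairOf := by
    refine fun w => Prod.ext ?_ (correlationError_pairOf w)
    dsimp only [pairOf]
    rw [phaseConj_phaseConj, sub_add_add_cancel, ← two_smul ℝ, smul_smul, one_div_mul_cancel
      two_ne_zero, one_smul]
  refine hinv.isClosedEmbedding ?_ continuous_pairOf
  unfold correlationError
  fun_prop

theorem measurePreserving_pairOf : MeasurePreserving pairOf volume volume := by
  have hmid : MeasurePreserving (fun w : Mode × Mode => (w.1, w.2 + (1 / 2 : ℝ) • w.1))
      (volume.prod volume) (volume.prod volume) :=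
    (MeasurePreserving.id volume).skew_product (g := fun s q => q + (1 / 2 : ℝ) • s) (by fun_prop)
      (.of_forall fun s => map_add_right_eq_self _ _)
  have hdiff : MeasurePreserving (fun w : Mode × Mode => (w.1, phaseConj (w.1 - w.2)))
      (volume.prod volume) (volume.prod volume) :=
    (MeasurePreserving.id volume).skew_product (g := fun b s => phaseConj (b - s)) (by fun_prop)
      (.of_forall fun b =>
        (measurePreserving_phaseConj.comp (Measure.measurePreserving_sub_left volume b)).map_eq)
  have hswap : MeasurePreserving (Prod.swap : Mode × Mode → Mode × Mode)
      (volume.prod volume) (volume.prod volume) := Measure.measurePreserving_swap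
  rw [Measure.volume_eq_prod]
  have hcomp : pairOf = Prod.swap ∘ (fun w : Mode × Mode => (w.1, phaseConj (w.1 - w.2))) ∘
      Prod.swap ∘ (fun w : Mode × Mode => (w.1, w.2 + (1 / 2 : ℝ) • w.1)) ∘ Prod.swap := by
    funext w
    simp only [pairOf, Function.comp_apply, Prod.swap]
    congr 2
    module
  rw [hcomp]
  exact hswap.comp (hdiff.comp (hswap.comp (hmid.comp hswap)))

theorem tmsvCov_neg_quadraticForm_pairOf (ζ : ℝ) (w : Mode × Mode) :
    ![(pairOf w).1.1, (pairOf w).1.2, (pairOf w).2.1, (pairOf w).2.2] ⬝ᵥ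
        (tmsvCov (-ζ)).mulVec ![(pairOf w).1.1, (pairOf w).1.2, (pairOf w).2.1, (pairOf w).2.2] =
      2 * Real.exp (-2 * ζ) * (w.1.1 ^ 2 + w.1.2 ^ 2) +
        Real.exp (2 * ζ) / 2 * (w.2.1 ^ 2 + w.2.2 ^ 2) := by
  simp only [tmsvCov, dotProduct, Matrix.mulVec, Fin.sum_univ_four, Real.cosh_eq, Real.sinh_eq,
    pairOf, phaseConj, Prod.fst_add, Prod.snd_add, Prod.fst_sub, Prod.snd_sub, Prod.smul_fst,
    Prod.smul_snd, smul_eq_mul, Matrix.of_apply, Matrix.cons_val]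
  ring_nf

theorem gaussianWigner_tmsvCov_pairOf (ζ : ℝ) (w : Mode × Mode) :
    gaussianWigner 2 (tmsvCov ζ) 0
        ![(pairOf w).1.1, (pairOf w).1.2, (pairOf w).2.1, (pairOf w).2.2] =
      isotropicPDF 0 (Real.toNNReal (Real.exp (2 * ζ) / 4)) w.1 *
        isotropicPDF 0 (Real.toNNReal (Real.exp (-2 * ζ))) w.2 := by
  have hexp : Real.exp (-2 * ζ) = (Real.exp (2 * ζ))⁻¹ := by rw [← Real.exp_neg, neg_mul]
  rw [gaussianWigner, inv_tmsvCov, det_tmsvCov, sub_zero, tmsvCov_neg_quadraticForm_pairOf,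
    isotropicPDF_eq, isotropicPDF_eq, Real.coe_toNNReal _ (by positivity),
    Real.coe_toNNReal _ (by positivity), mul_mul_mul_comm, ← Real.exp_add, hexp, Real.sqrt_one]
  simp only [Prod.fst_zero, Prod.snd_zero, sub_zero]
  congr 1
  · field_simp
    norm_num
  · congr 1
    field_simp
    ring

theorem continuous_gaussianWigner (N : ℕ) (Γ : Matrix (Fin (2 * N)) (Fin (2 * N)) ℝ)
    (d : Fin (2 * N) → ℝ) : Continuous (gaussianWigner N Γ d) := by
  unfold gaussianWigner
  fun_prop

theorem tmsvState_eq_map (ζ : ℝ) :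
    tmsvState ζ = ((isotropicGaussian 0 (Real.toNNReal (Real.exp (2 * ζ) / 4))).prod
      (isotropicGaussian 0 (Real.toNNReal (Real.exp (-2 * ζ))))).map pairOf := by
  have hW : Measurable fun z : Mode × Mode => ENNReal.ofReal
      (gaussianWigner 2 (tmsvCov ζ) 0 ![z.1.1, z.1.2, z.2.1, z.2.2]) :=
    ((continuous_gaussianWigner 2 _ _).comp (by fun_prop)).measurable.ennreal_ofReal
  refine Measure.ext_of_lintegral _ fun f hf => ?_
  rw [isotropicGaussian_eq_withDensity _ (Real.toNNReal_pos.2 (by positivity)).ne',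
    isotropicGaussian_eq_withDensity _ (Real.toNNReal_pos.2 (by positivity)).ne',
    prod_withDensity (by fun_prop) (by fun_prop), lintegral_map hf (by fun_prop),
    lintegral_withDensity_eq_lintegral_mul _ (by fun_prop) (by fun_prop), tmsvState,
    lintegral_withDensity_eq_lintegral_mul _ hW hf,
    ← measurePreserving_pairOf.lintegral_comp (hW.mul hf), ← Measure.volume_eq_prod]
  simp only [Pi.mul_apply, gaussianWigner_tmsvCov_pairOf,
    ENNReal.ofReal_mul (isotropicPDF_nonneg _ _ _)]

instance isProbabilityMeasure_tmsvState (ζ : ℝ) : IsProbabilityMeasure (tmsvState ζ) := by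
  rw [tmsvState_eq_map]
  exact Measure.isProbabilityMeasure_map (by fun_prop)

theorem map_correlationError_tmsvState (ζ : ℝ) :
    (tmsvState ζ).map correlationError =
      isotropicGaussian 0 (Real.toNNReal (Real.exp (-2 * ζ))) := by
  rw [tmsvState_eq_map, Measure.map_map (by fun_prop) (by fun_prop),
    show correlationError ∘ pairOf = Prod.snd from funext correlationError_pairOf,
    Measure.map_snd_prod, measure_univ, one_smul]

theorem idealEPR_eq_map (C : ℝ) :
    idealEPR C = ENNReal.ofReal C • (volume : Measure Mode).map fun q => pairOf (q, 0) := by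
  conv_lhs => rw [idealEPR, ← measurePreserving_phaseConj.map_eq,
    Measure.map_map (by fun_prop) (by fun_prop)]
  congr 2
  funext q
  simp only [Function.comp_apply, pairOf, smul_zero, sub_zero, add_zero]
  exact congrArg (phaseConj q, ·) (phaseConj_phaseConj q)

theorem tendsto_exp_neg_two_mul_atTop :
    Tendsto (fun ζ : ℝ => Real.exp (-2 * ζ)) atTop (𝓝 0) :=
  Real.tendsto_exp_atBot.comp (tendsto_id.const_mul_atTop_of_neg (by norm_num))

theorem map_snd_noisyAttackRound_tmsvState {t u : ℝ} (ht : 0 ≤ t) (htu : t ≤ 1 + 2 * u) (θ : ℝ)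
    (z₀ : Mode) (ζ : ℝ) :
    (noisyAttackRound t u (coherentState z₀) (tmsvState ζ) θ).map Prod.snd =
      (gaussianReal (√t * quadrature θ z₀)
        (Real.toNNReal (1 / 2 + u + t * Real.exp (-2 * ζ)))).map toBoth := by
  rw [map_snd_noisyAttackRound, map_correlationError_tmsvState, homodyne_coherentState,
    homodyne_isotropicGaussian, gaussianReal_conv_gaussianReal,
    addChannelNoise_gaussianReal ht htu, NNReal.coe_add, Real.coe_toNNReal _ (Real.exp_pos _).le]
  congr 2
  · simp only [quadrature, Prod.fst_zero, Prod.snd_zero, zero_mul, add_zero]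
  · push_cast
    ring_nf

theorem eventually_abs_map_snd_noisyAttackRound_tmsvState_sub_le {t u : ℝ} (ht : 0 ≤ t)
    (htu : t ≤ 1 + 2 * u) (hu : 0 < 1 + 2 * u) (θ : ℝ) (z₀ : Mode) {δ : ℝ} (hδ : 0 < δ) :
    ∀ᶠ ζ : ℝ in atTop, ∀ S : Set (ℝ × ℝ), MeasurableSet S →
      |((noisyAttackRound t u (coherentState z₀) (tmsvState ζ) θ).map Prod.snd).real S -
        ((homodyne θ (noisyCoherentState t u z₀)).map toBoth).real S| ≤ δ := by
  have hvar : Tendsto (fun ζ : ℝ => Real.toNNReal (1 / 2 + u + t * Real.exp (-2 * ζ))) atTop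
      (𝓝 (Real.toNNReal (1 / 2 + u))) := by
    simpa using tendsto_real_toNNReal
      ((tendsto_exp_neg_two_mul_atTop.const_mul t).const_add (1 / 2 + u))
  have hpos : Real.toNNReal (1 / 2 + u) ≠ 0 := (Real.toNNReal_pos.2 (by linarith)).ne'
  filter_upwards [eventually_abs_gaussianReal_real_sub_le hpos
    (tendsto_const_nhds (x := √t * quadrature θ z₀)) hvar hδ] with ζ hζ S hS
  rw [map_snd_noisyAttackRound_tmsvState ht htu, homodyne_noisyCoherentState t hu,
    map_measureReal_apply measurable_toBoth hS, map_measureReal_apply measurable_toBoth hS]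
  exact hζ _

theorem tendsto_integral_tmsvState {f : Mode × Mode → ℝ} (hf : Continuous f)
    (hc : HasCompactSupport f) :
    Tendsto (fun ζ : ℝ => Real.pi / 2 * Real.exp (2 * ζ) * ∫ z, f z ∂(tmsvState ζ)) atTop
      (𝓝 (∫ z, f z ∂(idealEPR 1))) := by
  have hspread : Tendsto (fun ζ : ℝ => Real.toNNReal (Real.exp (2 * ζ) / 4)) atTop atTop :=
    tendsto_real_toNNReal_atTop.comp <| (Real.tendsto_exp_atTop.comp
      (tendsto_id.const_mul_atTop zero_lt_two)).atTop_div_const (by norm_num)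
  have hsqueeze : Tendsto (fun ζ : ℝ => Real.toNNReal (Real.exp (-2 * ζ))) atTop (𝓝 0) := by
    simpa using tendsto_real_toNNReal tendsto_exp_neg_two_mul_atTop
  rw [idealEPR_eq_map, ENNReal.ofReal_one, one_smul, integral_map (by fun_prop) (by fun_prop)]
  refine (tendsto_mul_integral_prod_isotropicGaussian hspread hsqueeze
    (hf.comp continuous_pairOf) (hc.comp_isClosedEmbedding isClosedEmbedding_pairOf)).congr
    fun ζ => ?_
  rw [tmsvState_eq_map, integral_map (by fun_prop) (by fun_prop),
    Real.coe_toNNReal _ (by positivity)]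
  simp only [Function.comp_apply]
  ring

end TwoModeSqueezedVacuum

section Timing

theorem intercept_eq (T : ℝ) {v p y : ℝ} (h : Wbtw ℝ v y p) :
    intercept T v p y = T - |y - p| := by
  have hdist : |v - y| + |y - p| = |v - p| := h.dist_add_dist
  rw [intercept, arrival, abs_sub_comm p v, abs_sub_comm y v]
  linarith

theorem attackArrival_eq (T : ℝ) {v v' p a b : ℝ} (ha : Wbtw ℝ v a p) (hp : Wbtw ℝ a p b)
    (hb : Wbtw ℝ p b v') : attackArrival T v v' p a b = arrival T p v := by
  have hva : |v - a| + |a - p| = |v - p| := ha.dist_add_dist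
  have hab : |a - p| + |p - b| = |a - b| := hp.dist_add_dist
  have hown : intercept T v p a = T - |a - p| := intercept_eq T ha
  have hother : arrival (intercept T v' p b) b a = T + |a - p| := by
    rw [intercept_eq T hb.symm, arrival, abs_sub_comm b p]
    linarith
  have hlater : T - |a - p| ≤ T + |a - p| := by linarith [abs_nonneg (a - p)]
  rw [attackArrival, hown, hother, max_eq_right hlater, arrival, arrival]
  linarith

end Timing

end CVQPV

open CVQPV in
theorem mainTheorem3_general :
    (∀ f : Mode × Mode → ℝ, Continuous f → HasCompactSupport f →
      Tendsto (fun ζ : ℝ => Real.pi / 2 * Real.exp (2 * ζ) * ∫ z, f z ∂(tmsvState ζ)) atTop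
        (𝓝 (∫ z, f z ∂(idealEPR 1)))) ∧
    (∀ C θ r rp : ℝ, 0 < C →
      homodyne θ (coherentState (challenge θ r rp)) = gaussianReal r (1 / 2) ∧
      (∀ f : Mode × Mode → ℝ≥0∞, Measurable f →
        ∫⁻ w, f (displacement w.1, w.2)
            ∂(teleport (coherentState (challenge θ r rp)) (idealEPR C)) =
          ENNReal.ofReal C * ∫⁻ d : Mode, ∫⁻ z, f (d, z) ∂(coherentState (challenge θ r rp + d))) ∧
      attackRound (coherentState (challenge θ r rp)) (idealEPR C) θ =
        (ENNReal.ofReal (2 * C) • (volume : Measure (ℝ × ℝ))).prod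
          ((homodyne θ (coherentState (challenge θ r rp))).map toBoth)) ∧
    (∀ t u : ℝ, 0 ≤ t → t ≤ 1 + 2 * u → 0 < 1 + 2 * u →
      (∀ C θ r rp : ℝ, 0 < C →
        homodyne θ (noisyCoherentState t u (challenge θ r rp)) =
          gaussianReal (√t * r) (Real.toNNReal (1 / 2 + u)) ∧
        noisyAttackRound t u (coherentState (challenge θ r rp)) (idealEPR C) θ =
          (ENNReal.ofReal (2 * C) • (volume : Measure (ℝ × ℝ))).prod
            ((homodyne θ (noisyCoherentState t u (challenge θ r rp))).map toBoth)) ∧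
      (∀ (n : ℕ) (θ r rp C : Fin n → ℝ) (D : Fin n → Set (ℝ × ℝ)), (∀ i, 0 < C i) →
        (∀ i, volume (D i) ≠ 0) → (∀ i, volume (D i) ≠ ∞) →
        Measure.pi (fun i => answersGiven (noisyAttackRound t u
            (coherentState (challenge (θ i) (r i) (rp i))) (idealEPR (C i)) (θ i)) (D i)) =
          Measure.pi (fun i =>
            (homodyne (θ i) (noisyCoherentState t u (challenge (θ i) (r i) (rp i)))).map
              toBoth)) ∧
      (∀ θ r rp : ℝ,
        (∀ ζ : ℝ,
          (noisyAttackRound t u (coherentState (challenge θ r rp)) (tmsvState ζ) θ).map Prod.snd =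
            (gaussianReal (√t * r)
              (Real.toNNReal (1 / 2 + u + t * Real.exp (-2 * ζ)))).map toBoth) ∧
        ∀ δ : ℝ, 0 < δ → ∀ᶠ ζ : ℝ in atTop, ∀ S : Set (ℝ × ℝ), MeasurableSet S →
          |((noisyAttackRound t u (coherentState (challenge θ r rp)) (tmsvState ζ) θ).map
              Prod.snd).real S -
            ((homodyne θ (noisyCoherentState t u (challenge θ r rp))).map toBoth).real S| ≤ δ)) ∧
    (∀ T v₁ v₂ p a b : ℝ, v₁ ≤ a → a ≤ p → p ≤ b → b ≤ v₂ →
      attackArrival T v₁ v₂ p a b = arrival T p v₁ ∧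
      attackArrival T v₂ v₁ p b a = arrival T p v₂) := by
  refine ⟨fun f => tendsto_integral_tmsvState, fun C θ r rp _ => ⟨?_, fun f => ?_, ?_⟩,
    fun t u ht htu hu => ⟨fun C θ r rp _ => ⟨?_, ?_⟩, ?_, fun θ r rp => ⟨fun ζ => ?_, fun δ => ?_⟩⟩,
    fun T v₁ v₂ p a b hva hap hpb hbv => ?_⟩
  · rw [homodyne_coherentState, quadrature_challenge]
  · exact lintegral_teleport_coherentState C _
  · exact attackRound_idealEPR _ C θ
  · rw [homodyne_noisyCoherentState t hu, quadrature_challenge]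
  · rw [noisyAttackRound_idealEPR, homodyne_noisyCoherentState_eq_addChannelNoise ht htu hu]
  · intro n θ r rp C D hC h0 htop
    congr! with i
    rw [answersGiven_noisyAttackRound_idealEPR t u _ (hC i) _ (h0 i) (htop i),
      homodyne_noisyCoherentState_eq_addChannelNoise ht htu hu]
  · rw [map_snd_noisyAttackRound_tmsvState ht htu, quadrature_challenge]
  · exact eventually_abs_map_snd_noisyAttackRound_tmsvState_sub_le ht htu hu θ _
  · have ha : Wbtw ℝ v₁ a p := .of_le_of_le hva hap
    have hp : Wbtw ℝ a p b := .of_le_of_le hap hpb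
    have hb : Wbtw ℝ p b v₂ := .of_le_of_le hpb hbv
    exact ⟨attackArrival_eq T ha hp hb, attackArrival_eq T hb.symm hp.symm ha.symm⟩

open CVQPV in
theorem mainTheorem3 :
    -- the ideal EPR pair is the (rescaled) limit of two-mode squeezed vacua
    (∀ f : Mode × Mode → ℝ, Continuous f → HasCompactSupport f →
      Tendsto (fun ζ : ℝ => Real.pi / 2 * Real.exp (2 * ζ) * ∫ z, f z ∂(tmsvState ζ)) atTop
        (𝓝 (∫ z, f z ∂(idealEPR 1)))) ∧
    -- one round, for every challenge and ideal pair
    (∀ C θ r rp : ℝ, 0 < C →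
      -- the honest prover: mean `r` and shot noise
      homodyne θ (coherentState (challenge θ r rp)) = gaussianReal r (1 / 2) ∧
      -- given the displacement `d`, Bob holds the coherent state displaced by `d`
      (∀ f : Mode × Mode → ℝ≥0∞, Measurable f →
        ∫⁻ w, f (displacement w.1, w.2) ∂(teleport (coherentState (challenge θ r rp)) (idealEPR C)) =
          ENNReal.ofReal C * ∫⁻ d : Mode, ∫⁻ z, f (d, z) ∂(coherentState (challenge θ r rp + d))) ∧
      -- Alice's outcome is uniform, and whatever it is, both answers are one sample of the
      -- honest distribution
      attackRound (coherentState (challenge θ r rp)) (idealEPR C) θ =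
        (ENNReal.ofReal (2 * C) • (volume : Measure (ℝ × ℝ))).prod
          ((homodyne θ (coherentState (challenge θ r rp))).map toBoth)) ∧
    -- channels with attenuation `t` and excess noise `u`
    (∀ t u : ℝ, 0 ≤ t → t ≤ 1 → 0 ≤ u →
      (∀ C θ r rp : ℝ, 0 < C →
        homodyne θ (noisyCoherentState t u (challenge θ r rp)) =
          gaussianReal (√t * r) (Real.toNNReal (1 / 2 + u)) ∧
        noisyAttackRound t u (coherentState (challenge θ r rp)) (idealEPR C) θ =
          (ENNReal.ofReal (2 * C) • (volume : Measure (ℝ × ℝ))).prod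
            ((homodyne θ (noisyCoherentState t u (challenge θ r rp))).map toBoth)) ∧
      -- `n` rounds: the answers have the honest law, hence the same acceptance probability
      (∀ (n : ℕ) (θ r rp C : Fin n → ℝ) (D : Fin n → Set (ℝ × ℝ)), (∀ i, 0 < C i) →
        (∀ i, MeasurableSet (D i)) → (∀ i, volume (D i) ≠ 0) → (∀ i, volume (D i) ≠ ∞) →
        Measure.pi (fun i => answersGiven (noisyAttackRound t u
            (coherentState (challenge (θ i) (r i) (rp i))) (idealEPR (C i)) (θ i)) (D i)) =
          Measure.pi (fun i =>
            (homodyne (θ i) (noisyCoherentState t u (challenge (θ i) (r i) (rp i)))).map toBoth) ∧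
        ∀ ε : ℝ, 0 < ε → ε < 1 →
          Measure.pi (fun i => answersGiven (noisyAttackRound t u
              (coherentState (challenge (θ i) (r i) (rp i))) (idealEPR (C i)) (θ i)) (D i))
              (accepted n t u ε r) =
            Measure.pi (fun i =>
              (homodyne (θ i) (noisyCoherentState t u (challenge (θ i) (r i) (rp i)))).map toBoth)
              (accepted n t u ε r)) ∧
      -- finite squeezing: the answers have the law `N(√t r, 1/2 + u + t e^{-2ζ})`, which tends to
      -- the honest law in total variation as `ζ → ∞`
      (∀ θ r rp : ℝ,
        (∀ ζ : ℝ, 0 ≤ ζ →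
          (noisyAttackRound t u (coherentState (challenge θ r rp)) (tmsvState ζ) θ).map Prod.snd =
            (gaussianReal (√t * r)
              (Real.toNNReal (1 / 2 + u + t * Real.exp (-2 * ζ)))).map toBoth) ∧
        ∀ δ : ℝ, 0 < δ → ∀ᶠ ζ : ℝ in atTop, ∀ S : Set (ℝ × ℝ), MeasurableSet S →
          |((noisyAttackRound t u (coherentState (challenge θ r rp)) (tmsvState ζ) θ).map
              Prod.snd).real S -
            ((homodyne θ (noisyCoherentState t u (challenge θ r rp))).map toBoth).real S| ≤ δ)) ∧
    -- timing: the attackers' answers arrive when those of an honest prover at `p` would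
    (∀ T v₁ v₂ p a b : ℝ, v₁ ≤ a → a ≤ p → p ≤ b → b ≤ v₂ →
      attackArrival T v₁ v₂ p a b = arrival T p v₁ ∧
      attackArrival T v₂ v₁ p b a = arrival T p v₂) := by
  obtain ⟨epr, noiseless, noisy, timing⟩ := mainTheorem3_general
  refine ⟨epr, noiseless, fun t u ht ht₁ hu => ?_, timing⟩
  obtain ⟨round, rounds, finite⟩ := noisy t u ht (by linarith) (by linarith)
  exact ⟨round, fun n θ r rp C D hC _ h0 htop =>
    ⟨rounds n θ r rp C D hC h0 htop, fun ε _ _ => by rw [rounds n θ r rp C D hC h0 htop]⟩,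
    fun θ r rp => ⟨fun ζ _ => (finite θ r rp).1 ζ, (finite θ r rp).2⟩⟩
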